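/- Let $S\subset\mathbb R^2$ be the $\frac13$-von Koch snowflake, i.e. the von Koch curve over the unit segment $[0,1]\times\{0\}$: the unique nonempty compact set with $S=f_1(S)\cup f_2(S)\cup f_3(S)\cup f_4(S)$, where $f_1,\dots,f_4$ are the orientation-preserving similarities of ratio $\frac13$ which map the segment from $(0,0)$ to $(1,0)$, in order, onto the four consecutive segments of the polygonal line with vertices $(0,0),(\frac13,0),(\frac12,\frac{\sqrt3}{6}),(\frac23,0),(1,0)$. For $A\subset\mathbb R^2$ let $B(A,r)=\{x\in\mathbb R^2:\operatorname{dist}(x,A)\le r\}$ be its closed $r$-neighborhood, and for $E\subset\mathbb R^2$ let $$\Lambda(E,r)=\inf\{\mathcal H^1(\Gamma):\Gamma\subset\mathbb R^2\text{ is a rectifiable curve and }B(\Gamma,r)\supset E\},$$ where a rectifiable curve is the image of a continuous map $[0,1]\to\mathbb R^2$ of finite length (not necessarily injective), and $\mathcal H^1$ is the one-dimensional Hausdorff measure. Then there exists a constant $C>1$ such that $$\frac1C\, r^{\frac{\alpha-1}{\alpha}}\le \Lambda(B(S,r),r)\le C\, r^{\frac{\alpha-1}{\alpha}}\qquad\text{for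 all } 0<r<1,$$ where $\alpha=\log_4 3$. -/

import Mathlib

open Set MeasureTheory

/-- A set `Γ` is a rectifiable curve if it is the image of a continuous map `γ : [0, 1] → X`
of finite length (the total variation of `γ` is its length). -/
def IsRectifiableCurve {X : Type*} [PseudoEMetricSpace X] (Γ : Set X) : Prop :=
  ∃ γ : ℝ → X, ContinuousOn γ (Icc (0 : ℝ) 1) ∧ BoundedVariationOn γ (Icc (0 : ℝ) 1) ∧
    γ '' Icc (0 : ℝ) 1 = Γ

/-- The value `Λ(E, r)` of the maximum distance problem in `ℝⁿ`: the infimum of `ℋ¹(Γ)` over all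
rectifiable curves `Γ` whose closed `r`-neighbourhood contains `E`. -/
noncomputable def maxDistValue {n : ℕ} (E : Set (EuclideanSpace ℝ (Fin n))) (r : ℝ) : ENNReal :=
  sInf {m : ENNReal | ∃ Γ : Set (EuclideanSpace ℝ (Fin n)),
    IsRectifiableCurve Γ ∧ E ⊆ Metric.cthickening r Γ ∧ m = Measure.hausdorffMeasure 1 Γ}

/-- The four orientation preserving similarities of ratio `1/3` that generate the von Koch curve
over the unit segment from `(0, 0)` to `(1, 0)`. They send this segment, in order, to the four
segments of the polygonal line
`(0, 0)`, `(1/3, 0)`, `(1/2, √3/6)`, `(2/3, 0)`, `(1, 0)`. -/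
noncomputable def kochMap (i : Fin 4) (p : EuclideanSpace ℝ (Fin 2)) : EuclideanSpace ℝ (Fin 2) :=
  match i with
  | 0 => !₂[p 0 / 3, p 1 / 3]
  | 1 => !₂[1 / 3 + (p 0 - √3 * p 1) / 6, (√3 * p 0 + p 1) / 6]
  | 2 => !₂[1 / 2 + (p 0 + √3 * p 1) / 6, √3 / 6 + (p 1 - √3 * p 0) / 6]
  | 3 => !₂[2 / 3 + p 0 / 3, p 1 / 3]

/-- `S` is a nonempty compact set that is the union of its four images under the Koch maps. -/
def IsKochInvariant (S : Set (EuclideanSpace ℝ (Fin 2))) : Prop :=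
  IsCompact S ∧ S.Nonempty ∧ S = ⋃ i : Fin 4, kochMap i '' S

/-- The Koch maps are similarities of ratio `1/3`. -/
theorem dist_kochMap (i : Fin 4) (p q : EuclideanSpace ℝ (Fin 2)) :
    dist (kochMap i p) (kochMap i q) = dist p q / 3 := by
  have h3 : √(3 : ℝ) ^ 2 = 3 := Real.sq_sqrt (by norm_num)
  have h9 : (3 : ℝ) = √9 := by
    rw [show (9 : ℝ) = 3 ^ 2 by norm_num, Real.sqrt_sq (by norm_num)]
  rw [EuclideanSpace.dist_eq, EuclideanSpace.dist_eq]
  conv_rhs => rw [h9, ← Real.sqrt_div' _ (by norm_num)]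
  congr 1
  simp only [Fin.sum_univ_two, Real.dist_eq, sq_abs]
  fin_cases i
  · simp [kochMap]; ring
  · simp [kochMap]; linear_combination ((p 0 - q 0) ^ 2 + (p 1 - q 1) ^ 2) / 36 * h3
  · simp [kochMap]; linear_combination ((p 0 - q 0) ^ 2 + (p 1 - q 1) ^ 2) / 36 * h3
  · simp [kochMap]; ring

theorem continuous_kochMap (i : Fin 4) : Continuous (kochMap i) := by
  refine (LipschitzWith.of_dist_le_mul (K := 1) fun p q => ?_).continuous
  rw [dist_kochMap]
  have := dist_nonneg (x := p) (y := q)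
  simp only [NNReal.coe_one, one_mul]
  linarith

theorem IsKochInvariant.subset {S T : Set (EuclideanSpace ℝ (Fin 2))}
    (hS : IsKochInvariant S) (hT : IsKochInvariant T) : S ⊆ T := by
  obtain ⟨hSc, hSn, hSe⟩ := hS
  obtain ⟨hTc, hTn, hTe⟩ := hT
  obtain ⟨x, hx, hmax⟩ := hSc.exists_isMaxOn hSn
    (Metric.continuous_infDist_pt T).continuousOn
  have key : Metric.infDist x T ≤ Metric.infDist x T / 3 := by
    have hx' := hx
    rw [hSe] at hx'
    obtain ⟨i, y, hy, rfl⟩ := mem_iUnion.1 hx'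
    obtain ⟨z, hz, hyz⟩ := hTc.exists_infDist_eq_dist hTn y
    have hz' : kochMap i z ∈ T := by
      rw [hTe]
      exact mem_iUnion.2 ⟨i, z, hz, rfl⟩
    have h1 := Metric.infDist_le_dist_of_mem (x := kochMap i y) hz'
    rw [dist_kochMap, ← hyz] at h1
    have h2 : Metric.infDist y T ≤ Metric.infDist (kochMap i y) T := hmax hy
    linarith
  intro w hw
  have h1 : Metric.infDist w T ≤ Metric.infDist x T := hmax hw
  have h0 := Metric.infDist_nonneg (x := w) (s := T)
  rw [hTc.isClosed.mem_iff_infDist_zero hTn]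
  linarith

theorem exists_isKochInvariant : ∃ S, IsKochInvariant S := by
  set F : Set (EuclideanSpace ℝ (Fin 2)) → Set (EuclideanSpace ℝ (Fin 2)) :=
    fun A => ⋃ i : Fin 4, kochMap i '' A with hF
  have hmono : ∀ {A B}, A ⊆ B → F A ⊆ F B := fun h => iUnion_mono fun i => image_mono h
  obtain ⟨R, hR⟩ : ∃ R : ℝ, ∀ i : Fin 4, dist (kochMap i 0) 0 ≤ R :=
    ⟨∑ i : Fin 4, dist (kochMap i 0) 0, fun i =>
      Finset.single_le_sum (f := fun i : Fin 4 => dist (kochMap i 0) 0)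
        (fun _ _ => dist_nonneg) (Finset.mem_univ i)⟩
  have hR0 : 0 ≤ R := dist_nonneg.trans (hR 0)
  have h00 : kochMap 0 0 = 0 := by
    ext j
    fin_cases j <;> simp [kochMap]
  have hball : F (Metric.closedBall 0 (2 * R)) ⊆ Metric.closedBall 0 (2 * R) := by
    refine iUnion_subset fun i => ?_
    rintro _ ⟨y, hy, rfl⟩
    rw [Metric.mem_closedBall] at hy ⊢
    have h1 := dist_triangle (kochMap i y) (kochMap i 0) 0
    rw [dist_kochMap] at h1
    have h2 := hR i
    linarith
  set U : ℕ → Set (EuclideanSpace ℝ (Fin 2)) := fun n => F^[n] {0} with hU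
  have hUs : ∀ n, U (n + 1) = F (U n) := fun n => Function.iterate_succ_apply' F n {0}
  have h0U : ∀ n, (0 : EuclideanSpace ℝ (Fin 2)) ∈ U n := by
    intro n
    induction n with
    | zero => simp [hU]
    | succ n ih =>
      rw [hUs]
      exact mem_iUnion.2 ⟨0, 0, ih, h00⟩
  have hUb : ∀ n, U n ⊆ Metric.closedBall 0 (2 * R) := by
    intro n
    induction n with
    | zero => simpa [hU] using hR0
    | succ n ih =>
      rw [hUs]
      exact (hmono ih).trans hball
  have hcl : IsCompact (closure (⋃ n, U n)) :=
    (isCompact_closedBall (0 : EuclideanSpace ℝ (Fin 2)) (2 * R)).of_isClosed_subset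
      isClosed_closure (closure_minimal (iUnion_subset hUb) Metric.isClosed_closedBall)
  refine ⟨closure (⋃ n, U n), hcl, ⟨0, subset_closure (mem_iUnion.2 ⟨0, h0U 0⟩)⟩, ?_⟩
  apply Subset.antisymm
  · refine closure_minimal (iUnion_subset fun n => ?_)
      (isCompact_iUnion fun i => hcl.image (continuous_kochMap i)).isClosed
    cases n with
    | zero =>
      intro x hx
      have hx0 : x = 0 := by simpa [hU] using hx
      subst hx0
      exact mem_iUnion.2 ⟨0, 0, subset_closure (mem_iUnion.2 ⟨0, h0U 0⟩), h00⟩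
    | succ n =>
      rw [hUs]
      exact hmono ((subset_iUnion U n).trans subset_closure)
  · refine iUnion_subset fun i => (image_closure_subset_closure_image
      (continuous_kochMap i)).trans (closure_mono ?_)
    rw [image_iUnion]
    refine iUnion_subset fun n => ?_
    refine Subset.trans ?_ (subset_iUnion U (n + 1))
    rw [hUs]
    exact subset_iUnion (fun i : Fin 4 => kochMap i '' U n) i

/-- There is exactly one nonempty compact set invariant under the four Koch maps. -/
theorem existsUnique_isKochInvariant : ∃! S, IsKochInvariant S := by
  obtain ⟨S, hS⟩ := exists_isKochInvariant
  exact ⟨S, hS, fun T hT => Subset.antisymm (hT.subset hS) (hS.subset hT)⟩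

/-- The `1/3`-von Koch snowflake `S` (the von Koch curve over the unit segment): the unique
nonempty compact set in the plane with `S = ⋃ i, kochMap i '' S`. -/
noncomputable def vonKochSnowflake : Set (EuclideanSpace ℝ (Fin 2)) :=
  existsUnique_isKochInvariant.choose

theorem isKochInvariant_vonKochSnowflake : IsKochInvariant vonKochSnowflake :=
  existsUnique_isKochInvariant.choose_spec.1

/-!
Let `f` consist of `N` similarities of ratio `c` forming a zipper, and let `N * c ^ s = 1`. The
operation `A ↦ ⋃ i, f i '' A` turns a curve joining the end vertices of the zipper into another one
whose length is `N * c` times larger, and it turns `r`-neighbourhoods into `c * r`-neighbourhoods.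
A curve whose `c`-neighbourhood contains the `1`-neighbourhood of `S` therefore has an `n`-th
iterate that is admissible for `c ^ (n + 1) ≤ r ≤ c ^ n`, of length comparable to
`(N * c) ^ n = (c ^ n) ^ (1 - s)`.

Conversely, the open set condition provides `N ^ n` points of `S` with mutual distances at least
`const * c ^ n`. If `r` is a small multiple of `c ^ n`, then an admissible curve `Γ` contains the
centres of `N ^ n` disjoint balls of radius `r`. Since the `r`-neighbourhood of `Γ` contains that of
`S`, and not merely `S`, the diameter of `Γ` is at least that of `S`; so `Γ` leaves each of the
balls, and by connectedness its length in each is at least `r`: in total `N ^ n * r`, which is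
comparable to `r ^ (1 - s)`.

The von Koch curve is the case `N = 4`, `c = 1 / 3`, `s = logb 3 4 = 1 / α`.
-/

/-- `Γ` is traced from `a` to `b` by a `1`-Lipschitz path whose time interval is `[0, L]`, hence a
curve of length at most `L`. With this parametrization, rather than one by `[0, 1]`, lengths add
under concatenation. -/
def IsCurveOfLengthLE {X : Type*} [PseudoMetricSpace X] (L : ℝ) (a b : X) (Γ : Set X) : Prop :=
  0 ≤ L ∧ ∃ γ : ℝ → X, LipschitzWith 1 γ ∧ γ 0 = a ∧ γ L = b ∧ γ '' Icc 0 L = Γ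

theorem lipschitzWith_of_lipschitzOnWith_Iic_of_lipschitzOnWith_Ici {X : Type*}
    [PseudoMetricSpace X] {K : NNReal} {γ : ℝ → X} {c : ℝ} (hle : LipschitzOnWith K γ (Iic c))
    (hge : LipschitzOnWith K γ (Ici c)) : LipschitzWith K γ := by
  refine LipschitzWith.of_dist_le_mul fun s t => ?_
  wlog hst : s ≤ t generalizing s t
  · rw [dist_comm, dist_comm s]
    exact this t s (le_of_not_ge hst)
  rcases le_total t c with htc | hct
  · exact hle.dist_le_mul s (hst.trans htc) t htc
  rcases le_total c s with hcs | hsc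
  · exact hge.dist_le_mul s hcs t (hcs.trans hst)
  calc dist (γ s) (γ t) ≤ dist (γ s) (γ c) + dist (γ c) (γ t) := dist_triangle _ _ _
    _ ≤ K * dist s c + K * dist c t :=
      add_le_add (hle.dist_le_mul s hsc c self_mem_Iic) (hge.dist_le_mul c self_mem_Ici t hct)
    _ = K * dist s t := by
      rw [← mul_add, dist_add_dist_of_mem_segment (segment_eq_Icc hst ▸ ⟨hsc, hct⟩)]

namespace IsCurveOfLengthLE

section PseudoMetricSpace

variable {X : Type*} [PseudoMetricSpace X] {L L₁ L₂ : ℝ} {a b c : X} {Γ Γ₁ Γ₂ : Set X}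

theorem trans (h₁ : IsCurveOfLengthLE L₁ a b Γ₁) (h₂ : IsCurveOfLengthLE L₂ b c Γ₂) :
    IsCurveOfLengthLE (L₁ + L₂) a c (Γ₁ ∪ Γ₂) := by
  obtain ⟨hL₁, γ₁, hγ₁, rfl, hb₁, rfl⟩ := h₁
  obtain ⟨hL₂, γ₂, hγ₂, hb₂, rfl, rfl⟩ := h₂
  let γ : ℝ → X := fun t => if t ≤ L₁ then γ₁ t else γ₂ (t - L₁)
  have hle : EqOn γ γ₁ (Iic L₁) := fun t ht => if_pos ht
  have hge : EqOn γ (fun t => γ₂ (t - L₁)) (Ici L₁) := by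
    intro t ht
    rcases (mem_Ici.1 ht).eq_or_lt with rfl | hlt
    · simp only [hle self_mem_Iic, sub_self, hb₁, hb₂]
    · exact if_neg hlt.not_ge
  refine ⟨add_nonneg hL₁ hL₂, γ, ?_, hle hL₁, ?_, ?_⟩
  · refine lipschitzWith_of_lipschitzOnWith_Iic_of_lipschitzOnWith_Ici (c := L₁)
      (fun s hs t ht => ?_) fun s hs t ht => ?_
    · rw [hle hs, hle ht]
      exact hγ₁ s t
    · rw [hge hs, hge ht, ← edist_sub_right s t L₁]
      exact hγ₂ _ _
  · simp only [hge (mem_Ici.2 (le_add_of_nonneg_right hL₂)), add_sub_cancel_left]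
  · rw [← Icc_union_Icc_eq_Icc hL₁ (le_add_of_nonneg_right hL₂), image_union,
      (hle.mono Icc_subset_Iic_self).image_eq, (hge.mono Icc_subset_Ici_self).image_eq,
      ← image_image γ₂ (· - L₁), image_sub_const_Icc, sub_self, add_sub_cancel_left]

theorem iUnion {n : ℕ} {L : Fin (n + 1) → ℝ} {z : Fin (n + 2) → X} {Γ : Fin (n + 1) → Set X}
    (h : ∀ i, IsCurveOfLengthLE (L i) (z i.castSucc) (z i.succ) (Γ i)) :
    IsCurveOfLengthLE (∑ i, L i) (z 0) (z (Fin.last _)) (⋃ i, Γ i) := by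
  induction n with
  | zero => simpa [iUnion_fin_add_one_eq_iUnion_succ] using h 0
  | succ n ih =>
    rw [Fin.sum_univ_succ, iUnion_fin_add_one_eq_iUnion_succ]
    exact (h 0).trans (ih (z := z ∘ Fin.succ) fun i => h i.succ)

theorem isRectifiableCurve (h : IsCurveOfLengthLE L a b Γ) : IsRectifiableCurve Γ := by
  obtain ⟨hL, γ, hγ, -, -, rfl⟩ := h
  have hγL : LipschitzWith (1 * L.toNNReal) fun t => γ (L * t) := hγ.comp <|
    LipschitzWith.of_dist_le_mul fun s t => by
      rw [Real.coe_toNNReal L hL, dist_eq_norm, dist_eq_norm, ← mul_sub, norm_mul,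
        Real.norm_of_nonneg hL]
  refine ⟨_, hγL.continuous.continuousOn, ?_, ?_⟩
  · simpa using hγL.locallyBoundedVariationOn univ 0 1 trivial trivial
  · rw [← image_image γ, image_mul_left_Icc hL zero_le_one, mul_zero, mul_one]

theorem dist_le (h : IsCurveOfLengthLE L a b Γ) : dist a b ≤ L := by
  obtain ⟨hL, γ, hγ, rfl, rfl, -⟩ := h
  simpa [abs_of_nonneg hL] using hγ.dist_le_mul 0 L

theorem hausdorffMeasure_le {X : Type*} [MetricSpace X] [MeasurableSpace X] [BorelSpace X]
    {a b : X} {Γ : Set X} (h : IsCurveOfLengthLE L a b Γ) : μH[1] Γ ≤ ENNReal.ofReal L := by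
  obtain ⟨-, γ, hγ, -, -, rfl⟩ := h
  simpa [hausdorffMeasure_real] using
    hγ.lipschitzOnWith.hausdorffMeasure_image_le (s := Icc 0 L) zero_le_one

end PseudoMetricSpace

section NormedSpace

variable {E : Type*} [NormedAddCommGroup E] [NormedSpace ℝ E]

theorem segment (a b : E) : IsCurveOfLengthLE (dist a b) a b (segment ℝ a b) := by
  rcases eq_or_ne a b with rfl | hab
  · exact ⟨dist_nonneg, fun _ => a, LipschitzWith.const' a, rfl, rfl, by simp⟩
  have hd : 0 < dist a b := dist_pos.2 hab
  refine ⟨hd.le, fun t => AffineMap.lineMap a b ((dist a b)⁻¹ * t),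
    LipschitzWith.of_dist_le_mul fun s t => ?_, by simp, by simp [hd.ne'], ?_⟩
  · rw [dist_lineMap_lineMap, dist_eq_norm, ← mul_sub, norm_mul, norm_inv,
      Real.norm_of_nonneg hd.le, mul_right_comm, inv_mul_cancel₀ hd.ne', dist_eq_norm,
      NNReal.coe_one]
  · rw [← image_image (AffineMap.lineMap a b), image_mul_left_Icc (inv_nonneg.2 hd.le) hd.le,
      mul_zero, inv_mul_cancel₀ hd.ne', segment_eq_image_lineMap]

theorem exists_of_finite {F : Set E} (hF : F.Finite) (a b : E) :
    ∃ L Γ, IsCurveOfLengthLE L a b Γ ∧ F ⊆ Γ := by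
  induction F, hF using Set.Finite.induction_on generalizing a with
  | empty => exact ⟨_, _, segment a b, empty_subset _⟩
  | @insert x F _ _ ih =>
    obtain ⟨L, Γ, hΓ, hFΓ⟩ := ih x
    exact ⟨_, _, (segment a x).trans hΓ, insert_subset (.inl (right_mem_segment ℝ a x))
      (hFΓ.trans subset_union_right)⟩

theorem exists_cthickening_subset [ProperSpace E] {S : Set E} (hS : IsCompact S) (r : ℝ) {ε : ℝ}
    (hε : 0 < ε) (a b : E) : ∃ L Γ, IsCurveOfLengthLE L a b Γ ∧
      Metric.cthickening r S ⊆ Metric.cthickening ε Γ := by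
  obtain ⟨F, -, hF, hcover⟩ := hS.cthickening.finite_cover_balls hε
  obtain ⟨L, Γ, hΓ, hFΓ⟩ := exists_of_finite hF a b
  exact ⟨L, Γ, hΓ, hcover.trans <| iUnion₂_subset fun x hx =>
    Metric.ball_subset_closedBall.trans (Metric.closedBall_subset_cthickening (hFΓ hx) ε)⟩

end NormedSpace

end IsCurveOfLengthLE

/-! ### Lower bounds for the length -/

theorem IsRectifiableCurve.isCompact {X : Type*} [PseudoEMetricSpace X] {Γ : Set X}
    (h : IsRectifiableCurve Γ) : IsCompact Γ := by
  obtain ⟨γ, hγ, -, rfl⟩ := h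
  exact isCompact_Icc.image_of_continuousOn hγ

theorem IsRectifiableCurve.isPreconnected {X : Type*} [PseudoEMetricSpace X] {Γ : Set X}
    (h : IsRectifiableCurve Γ) : IsPreconnected Γ := by
  obtain ⟨γ, hγ, -, rfl⟩ := h
  exact isPreconnected_Icc.image γ hγ

section HausdorffMeasure

variable {X : Type*} [MetricSpace X] [MeasurableSpace X] [BorelSpace X] {Γ : Set X} {a b : X}

-- By connectedness the `1`-Lipschitz function `dist · a` maps `Γ ∩ ball a ρ` onto `[0, ρ)`.
theorem ofReal_le_hausdorffMeasure_inter_ball (hΓ : IsPreconnected Γ) (ha : a ∈ Γ) (hb : b ∈ Γ)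
    {ρ : ℝ} (hρ : ρ ≤ dist a b) : ENNReal.ofReal ρ ≤ μH[1] (Γ ∩ Metric.ball a ρ) := by
  have hsub : Ico 0 ρ ⊆ (dist · a) '' (Γ ∩ Metric.ball a ρ) := by
    rintro t ⟨ht0, htρ⟩
    obtain ⟨x, hx, rfl⟩ := (hΓ.image (dist · a) (by fun_prop)).Icc_subset
      ⟨a, ha, dist_self a⟩ ⟨b, hb, dist_comm b a⟩ ⟨ht0, htρ.le.trans hρ⟩
    exact ⟨x, ⟨hx, htρ⟩, rfl⟩
  calc ENNReal.ofReal ρ = μH[1] (Ico 0 ρ) := by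
        rw [hausdorffMeasure_real, Real.volume_Ico, sub_zero]
    _ ≤ μH[1] ((dist · a) '' (Γ ∩ Metric.ball a ρ)) := measure_mono hsub
    _ ≤ μH[1] (Γ ∩ Metric.ball a ρ) := by
      simpa using (LipschitzWith.dist_left a).lipschitzOnWith.hausdorffMeasure_image_le zero_le_one

theorem ofReal_dist_le_hausdorffMeasure (hΓ : IsPreconnected Γ) (ha : a ∈ Γ) (hb : b ∈ Γ) :
    ENNReal.ofReal (dist a b) ≤ μH[1] Γ :=
  (ofReal_le_hausdorffMeasure_inter_ball hΓ ha hb le_rfl).trans (measure_mono inter_subset_left)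

theorem card_mul_le_hausdorffMeasure {ι : Type*} [Fintype ι] {r : ℝ} {x : ι → X}
    (hΓ : IsPreconnected Γ) (ha : a ∈ Γ) (hb : b ∈ Γ) (hab : 2 * r ≤ dist a b)
    (hx : ∀ i, ∃ y ∈ Γ, dist (x i) y ≤ r)
    (hsep : Pairwise fun i j => 4 * r ≤ dist (x i) (x j)) :
    Fintype.card ι * ENNReal.ofReal r ≤ μH[1] Γ := by
  choose y hyΓ hy using hx
  have hball (i : ι) : ENNReal.ofReal r ≤ μH[1] (Γ ∩ Metric.ball (y i) r) := by
    rcases le_total r (dist (y i) a) with h | h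
    · exact ofReal_le_hausdorffMeasure_inter_ball hΓ (hyΓ i) ha h
    · refine ofReal_le_hausdorffMeasure_inter_ball hΓ (hyΓ i) hb ?_
      linarith [dist_triangle_left a b (y i)]
  have hdisj : Pairwise fun i j => Disjoint (Metric.ball (y i) r) (Metric.ball (y j) r) :=
    fun i j hij => Metric.ball_disjoint_ball <| by
      linarith [hsep hij, dist_triangle4_right (x i) (x j) (y i) (y j), hy i, hy j]
  calc (Fintype.card ι : ENNReal) * ENNReal.ofReal r
      = ∑ _i : ι, ENNReal.ofReal r := by simp
    _ ≤ ∑ i, μH[1].restrict Γ (Metric.ball (y i) r) := by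
      refine Finset.sum_le_sum fun i _ => ?_
      rw [Measure.restrict_apply measurableSet_ball, inter_comm]
      exact hball i
    _ ≤ μH[1].restrict Γ univ :=
      sum_measure_le_measure_univ (fun i _ => measurableSet_ball.nullMeasurableSet)
        fun i _ j _ hij => (hdisj hij).aedisjoint
    _ = μH[1] Γ := Measure.restrict_apply_univ Γ

end HausdorffMeasure

-- The points `a'`, `b'` are close to the ends of the segment `[a, b]` extended by `r` both ways.
theorem exists_dist_le_of_closedBall_subset_cthickening {E : Type*} [NormedAddCommGroup E]
    [NormedSpace ℝ E] [ProperSpace E] {Γ : Set E} (hΓ : IsClosed Γ) {r : ℝ} (hr : 0 ≤ r) {a b : E}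
    (ha : Metric.closedBall a r ⊆ Metric.cthickening r Γ)
    (hb : Metric.closedBall b r ⊆ Metric.cthickening r Γ) :
    ∃ a' ∈ Γ, ∃ b' ∈ Γ, dist a b ≤ dist a' b' := by
  rw [hΓ.cthickening_eq_biUnion_closedBall hr] at ha hb
  set u : E := (r / ‖b - a‖) • (b - a) with hu
  have hur : ‖u‖ ≤ r := by
    rw [norm_smul, Real.norm_of_nonneg (by positivity), div_mul_eq_mul_div, mul_div_assoc]
    exact mul_le_of_le_one_right hr (div_self_le_one _)
  obtain ⟨a', ha', haa'⟩ := mem_iUnion₂.1 (ha (show a - u ∈ _ by simpa using hur))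
  obtain ⟨b', hb', hbb'⟩ := mem_iUnion₂.1 (hb (show b + u ∈ _ by simpa using hur))
  refine ⟨a', ha', b', hb', ?_⟩
  rcases eq_or_ne a b with rfl | hab
  · simp
  have hnorm : 0 < ‖b - a‖ := norm_pos_iff.2 (sub_ne_zero.2 hab.symm)
  have hfar : dist (a - u) (b + u) = dist a b + 2 * r := by
    have hsmul : b + u - (a - u) = (1 + 2 * (r / ‖b - a‖)) • (b - a) := by
      rw [hu]
      module
    rw [dist_comm, dist_eq_norm, hsmul, norm_smul, Real.norm_of_nonneg (by positivity), dist_comm,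
      dist_eq_norm]
    field_simp
  linarith [dist_triangle4 (a - u) a' b' (b + u), Metric.mem_closedBall.1 haa',
    Metric.mem_closedBall'.1 hbb']

section MaxDistValue

variable {d : ℕ} {S Γ : Set (EuclideanSpace ℝ (Fin d))} {a b : EuclideanSpace ℝ (Fin d)} {r : ℝ}

theorem IsCurveOfLengthLE.maxDistValue_le {L : ℝ} (h : IsCurveOfLengthLE L a b Γ)
    (hS : S ⊆ Metric.cthickening r Γ) : maxDistValue S r ≤ ENNReal.ofReal L :=
  have hle : maxDistValue S r ≤ μH[1] Γ := sInf_le ⟨Γ, h.isRectifiableCurve, hS, rfl⟩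
  hle.trans h.hausdorffMeasure_le

theorem IsRectifiableCurve.exists_dist_le (hΓ : IsRectifiableCurve Γ) (hr : 0 ≤ r) (ha : a ∈ S)
    (hb : b ∈ S) (hS : Metric.cthickening r S ⊆ Metric.cthickening r Γ) :
    ∃ a' ∈ Γ, ∃ b' ∈ Γ, dist a b ≤ dist a' b' :=
  exists_dist_le_of_closedBall_subset_cthickening hΓ.isCompact.isClosed hr
    ((Metric.closedBall_subset_cthickening ha r).trans hS)
    ((Metric.closedBall_subset_cthickening hb r).trans hS)

theorem ofReal_dist_le_maxDistValue (hr : 0 ≤ r) (ha : a ∈ S) (hb : b ∈ S) :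
    ENNReal.ofReal (dist a b) ≤ maxDistValue (Metric.cthickening r S) r := by
  refine le_sInf ?_
  rintro _ ⟨Γ, hΓ, hS, rfl⟩
  obtain ⟨a', ha', b', hb', hle⟩ := hΓ.exists_dist_le hr ha hb hS
  exact (ENNReal.ofReal_le_ofReal hle).trans
    (ofReal_dist_le_hausdorffMeasure hΓ.isPreconnected ha' hb')

theorem card_mul_le_maxDistValue {ι : Type*} [Fintype ι] {x : ι → EuclideanSpace ℝ (Fin d)}
    (hr : 0 ≤ r) (ha : a ∈ S) (hb : b ∈ S) (hab : 2 * r ≤ dist a b) (hx : ∀ i, x i ∈ S)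
    (hsep : Pairwise fun i j => 4 * r ≤ dist (x i) (x j)) :
    Fintype.card ι * ENNReal.ofReal r ≤ maxDistValue (Metric.cthickening r S) r := by
  refine le_sInf ?_
  rintro _ ⟨Γ, hΓ, hS, rfl⟩
  obtain ⟨a', ha', b', hb', hle⟩ := hΓ.exists_dist_le hr ha hb hS
  refine card_mul_le_hausdorffMeasure hΓ.isPreconnected ha' hb' (hab.trans hle) (fun i => ?_) hsep
  have hxi := hS (Metric.self_subset_cthickening S (hx i))
  simpa only [hΓ.isCompact.cthickening_eq_biUnion_closedBall hr, mem_iUnion₂, exists_prop,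
    Metric.mem_closedBall] using hxi

end MaxDistValue

/-! ### Iterated function systems of similarities -/

/-- `f` multiplies all distances by `c`: the unbundled form of Mathlib's `Dilation` with a
prescribed ratio. -/
def IsSimilarity {X : Type*} [PseudoMetricSpace X] (c : ℝ) (f : X → X) : Prop :=
  ∀ x y, dist (f x) (f y) = c * dist x y

namespace IsSimilarity

section PseudoMetricSpace

variable {X : Type*} [PseudoMetricSpace X] {c c' r : ℝ} {f g : X → X}

theorem comp (hf : IsSimilarity c f) (hg : IsSimilarity c' g) : IsSimilarity (c * c') (f ∘ g) :=
  fun x y => by rw [Function.comp_apply, Function.comp_apply, hf, hg, mul_assoc]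

theorem lipschitzWith (hf : IsSimilarity c f) : LipschitzWith c.toNNReal f :=
  LipschitzWith.of_dist_le_mul fun x y =>
    (hf x y).trans_le (mul_le_mul_of_nonneg_right (Real.le_coe_toNNReal c) dist_nonneg)

theorem image_closedBall (hf : IsSimilarity c f) (hc : 0 < c) (hsurj : Function.Surjective f)
    (x : X) (r : ℝ) : f '' Metric.closedBall x r = Metric.closedBall (f x) (c * r) := by
  have hpre : f ⁻¹' Metric.closedBall (f x) (c * r) = Metric.closedBall x r := by
    ext y
    simp only [mem_preimage, Metric.mem_closedBall, hf y x, mul_le_mul_iff_right₀ hc]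
  rw [← hpre, image_preimage_eq _ hsurj]

end PseudoMetricSpace

theorem injective {X : Type*} [MetricSpace X] {c : ℝ} {f : X → X} (hf : IsSimilarity c f)
    (hc : c ≠ 0) : Function.Injective f := fun x y hxy => by
  have h := hf x y
  rw [hxy, dist_self, zero_eq_mul] at h
  exact dist_eq_zero.1 (h.resolve_left hc)

theorem surjective {E : Type*} [NormedAddCommGroup E] [NormedSpace ℝ E] [StrictConvexSpace ℝ E]
    [FiniteDimensional ℝ E] {c : ℝ} {f : E → E} (hf : IsSimilarity c f) (hc : 0 < c) :
    Function.Surjective f := by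
  have hiso : Isometry fun x => c⁻¹ • f x := Isometry.of_dist_eq fun x y => by
    rw [dist_smul₀, hf, Real.norm_of_nonneg (inv_nonneg.2 hc.le), inv_mul_cancel_left₀ hc.ne']
  have : Inhabited E := ⟨0⟩
  intro y
  obtain ⟨x, hx⟩ :=
    (hiso.affineIsometryOfStrictConvexSpace.toAffineIsometryEquiv rfl).surjective (c⁻¹ • y)
  exact ⟨x, smul_right_injective E (inv_ne_zero hc.ne') hx⟩

end IsSimilarity

theorem IsCurveOfLengthLE.image {X : Type*} [PseudoMetricSpace X] {c L : ℝ} {f : X → X} {a b : X}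
    {Γ : Set X} (h : IsCurveOfLengthLE L a b Γ) (hf : IsSimilarity c f) (hc : 0 < c) :
    IsCurveOfLengthLE (c * L) (f a) (f b) (f '' Γ) := by
  obtain ⟨hL, γ, hγ, rfl, rfl, rfl⟩ := h
  refine ⟨mul_nonneg hc.le hL, fun t => f (γ (c⁻¹ * t)), ?_, by simp, by simp [hc.ne'], ?_⟩
  · refine LipschitzWith.of_dist_le_mul fun s t => ?_
    calc dist (f (γ (c⁻¹ * s))) (f (γ (c⁻¹ * t)))
        = c * dist (γ (c⁻¹ * s)) (γ (c⁻¹ * t)) := hf _ _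
      _ ≤ c * dist (c⁻¹ * s) (c⁻¹ * t) := by
        gcongr
        simpa using hγ.dist_le_mul (c⁻¹ * s) (c⁻¹ * t)
      _ = (1 : NNReal) * dist s t := by
        rw [dist_eq_norm, ← mul_sub, norm_mul, Real.norm_of_nonneg (inv_nonneg.2 hc.le),
          mul_inv_cancel_left₀ hc.ne', dist_eq_norm, NNReal.coe_one, one_mul]
  · rw [← image_image f, ← image_image γ, image_mul_left_Icc (inv_nonneg.2 hc.le) (by positivity),
      mul_zero, inv_mul_cancel_left₀ hc.ne']

theorem mem_of_isFixedPt_of_contractingWith {X : Type*} [MetricSpace X] [CompleteSpace X]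
    {K : NNReal} {f : X → X} (hf : ContractingWith K f) {S : Set X} (hS : IsClosed S)
    (hne : S.Nonempty)
    (hmaps : MapsTo f S S) {a : X} (ha : Function.IsFixedPt f a) : a ∈ S := by
  obtain ⟨x, hx⟩ := hne
  have : Nonempty X := ⟨x⟩
  rw [hf.fixedPoint_unique ha]
  exact hS.mem_of_tendsto (hf.tendsto_iterate_fixedPoint x)
    (.of_forall fun n => hmaps.iterate n hx)

section IteratedFunctionSystem

variable {X ι : Type*} {f : ι → X → X} {A : Set X} {w w' : List ι}

theorem mapsTo_foldr (hA : ∀ i, MapsTo (f i) A A) (w : List ι) :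
    MapsTo (fun x => w.foldr f x) A A := by
  induction w with
  | nil => exact mapsTo_id A
  | cons i w ih => exact (hA i).comp ih

theorem mapsTo_of_eq_iUnion_image (hfA : A = ⋃ i, f i '' A) (i : ι) : MapsTo (f i) A A :=
  fun _ hx => hfA ▸ mem_iUnion.2 ⟨i, mem_image_of_mem _ hx⟩

theorem surjective_foldr (hf : ∀ i, Function.Surjective (f i)) (w : List ι) :
    Function.Surjective fun x => w.foldr f x := by
  induction w with
  | nil => exact Function.surjective_id
  | cons i w ih => exact (hf i).comp ih

variable [MetricSpace X] {c δ r : ℝ} {x y : X}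

theorem isSimilarity_foldr (hf : ∀ i, IsSimilarity c (f i)) (w : List ι) :
    IsSimilarity (c ^ w.length) fun x => w.foldr f x := by
  induction w with
  | nil => exact fun x y => (one_mul _).symm
  | cons i w ih =>
    rw [List.length_cons, pow_succ']
    exact (hf i).comp ih

theorem cthickening_iUnion_image [Finite ι] (hf : ∀ i, IsSimilarity c (f i))
    (hsurj : ∀ i, Function.Surjective (f i)) (hc : 0 < c) (hA : IsCompact A) (hr : 0 ≤ r) :
    Metric.cthickening (c * r) (⋃ i, f i '' A) = ⋃ i, f i '' Metric.cthickening r A := by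
  have hfA : IsCompact (⋃ i, f i '' A) :=
    isCompact_iUnion fun i => hA.image (hf i).lipschitzWith.continuous
  rw [hA.cthickening_eq_biUnion_closedBall hr,
    hfA.cthickening_eq_biUnion_closedBall (by positivity)]
  simp only [biUnion_iUnion, biUnion_image, image_iUnion, (hf _).image_closedBall hc (hsurj _)]

/-- `O` witnesses the open set condition for the iterated function system `f`: it is an open set
mapped by the maps `f i` into pairwise disjoint subsets of itself. -/
structure IsFeasibleOpenSet (f : ι → X → X) (O : Set X) : Prop where
  isOpen : IsOpen O
  mapsTo : ∀ i, MapsTo (f i) O O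
  pairwise_disjoint_image : Pairwise fun i j => Disjoint (f i '' O) (f j '' O)

variable {O : Set X}

theorem IsFeasibleOpenSet.eq_of_foldr_eq_foldr (hO : IsFeasibleOpenSet f O)
    (hinj : ∀ i, Function.Injective (f i)) (hx : x ∈ O) (hy : y ∈ O)
    (hlen : w.length = w'.length) (h : w.foldr f x = w'.foldr f y) : w = w' := by
  induction w generalizing w' with
  | nil => exact (List.length_eq_zero_iff.1 hlen.symm).symm
  | cons i w ih =>
    obtain ⟨j, w', rfl⟩ := List.exists_cons_of_length_eq_add_one hlen.symm
    rw [List.foldr_cons, List.foldr_cons] at h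
    obtain rfl : i = j := hO.pairwise_disjoint_image.eq <| not_disjoint_iff.2
      ⟨_, mem_image_of_mem _ (mapsTo_foldr hO.mapsTo w hx),
        h ▸ mem_image_of_mem _ (mapsTo_foldr hO.mapsTo w' hy)⟩
    rw [ih (Nat.succ_injective hlen) (hinj i h)]

theorem IsFeasibleOpenSet.le_dist_foldr (hO : IsFeasibleOpenSet f O)
    (hf : ∀ i, IsSimilarity c (f i)) (hsurj : ∀ i, Function.Surjective (f i)) (hc : 0 < c)
    (hx : Metric.ball x δ ⊆ O) (hδ : 0 < δ) (hlen : w.length = w'.length) (hne : w ≠ w') :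
    c ^ w.length * δ ≤ dist (w.foldr f x) (w'.foldr f x) := by
  obtain ⟨y, hy : w.foldr f y = w'.foldr f x⟩ := surjective_foldr hsurj w (w'.foldr f x)
  contrapose! hne
  rw [← hy, isSimilarity_foldr hf w, mul_lt_mul_iff_right₀ (pow_pos hc _), dist_comm] at hne
  exact hO.eq_of_foldr_eq_foldr (fun i => (hf i).injective hc.ne') (hx hne)
    (hx (Metric.mem_ball_self hδ)) hlen hy

theorem IsFeasibleOpenSet.exists_separated (hO : IsFeasibleOpenSet f O)
    (hf : ∀ i, IsSimilarity c (f i)) (hsurj : ∀ i, Function.Surjective (f i)) (hc : 0 < c)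
    (hOA : (O ∩ A).Nonempty) (hfA : A = ⋃ i, f i '' A) :
    ∃ δ > 0, ∀ n : ℕ, ∃ x : List.Vector ι n → X,
      (∀ w, x w ∈ A) ∧ Pairwise fun w w' => c ^ n * δ ≤ dist (x w) (x w') := by
  obtain ⟨p, hpO, hpA⟩ := hOA
  obtain ⟨δ, hδ, hball⟩ := Metric.isOpen_iff.1 hO.isOpen p hpO
  refine ⟨δ, hδ, fun n => ⟨fun w => w.toList.foldr f p,
    fun w => mapsTo_foldr (mapsTo_of_eq_iUnion_image hfA) _ hpA, fun w w' hne => ?_⟩⟩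
  have h := hO.le_dist_foldr hf hsurj hc hball hδ
    (w.toList_length.trans w'.toList_length.symm) (Subtype.coe_injective.ne hne)
  rwa [w.toList_length] at h

end IteratedFunctionSystem

/-- `f` is a zipper (in the sense of Aseev, Tetenov and Kravchenko) with vertices `z`: the map
`f i` sends the pair of end vertices to the `i`-th pair of consecutive vertices. -/
def IsZipper {X : Type*} {m : ℕ} (f : Fin (m + 1) → X → X) (z : Fin (m + 2) → X) : Prop :=
  ∀ i, f i (z 0) = z i.castSucc ∧ f i (z (Fin.last _)) = z i.succ

namespace IsZipper

variable {m : ℕ}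

section Vertices

variable {X : Type*} {f : Fin (m + 1) → X → X} {z : Fin (m + 2) → X}

theorem isFixedPt_zero (hz : IsZipper f z) : Function.IsFixedPt (f 0) (z 0) :=
  (hz 0).1

theorem isFixedPt_last (hz : IsZipper f z) :
    Function.IsFixedPt (f (Fin.last m)) (z (Fin.last _)) :=
  (hz (Fin.last m)).2

theorem vertices_mem [MetricSpace X] [CompleteSpace X] (hz : IsZipper f z) {c : ℝ} {S : Set X}
    (hf : ∀ i, IsSimilarity c (f i)) (hc : c < 1) (hS : IsClosed S) (hne : S.Nonempty)
    (hfS : S = ⋃ i, f i '' S) : z 0 ∈ S ∧ z (Fin.last _) ∈ S := by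
  have hcon (i : Fin (m + 1)) : ContractingWith c.toNNReal (f i) :=
    ⟨Real.toNNReal_lt_one.2 hc, (hf i).lipschitzWith⟩
  have hmaps := mapsTo_of_eq_iUnion_image hfS
  exact ⟨mem_of_isFixedPt_of_contractingWith (hcon _) hS hne (hmaps _) hz.isFixedPt_zero,
    mem_of_isFixedPt_of_contractingWith (hcon _) hS hne (hmaps _) hz.isFixedPt_last⟩

theorem isCurveOfLengthLE_iUnion_image [PseudoMetricSpace X] (hz : IsZipper f z) {c L : ℝ}
    {Γ : Set X} (hf : ∀ i, IsSimilarity c (f i)) (hc : 0 < c)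
    (hΓ : IsCurveOfLengthLE L (z 0) (z (Fin.last _)) Γ) :
    IsCurveOfLengthLE ((m + 1) * c * L) (z 0) (z (Fin.last _)) (⋃ i, f i '' Γ) := by
  have hi (i : Fin (m + 1)) : IsCurveOfLengthLE (c * L) (z i.castSucc) (z i.succ) (f i '' Γ) := by
    have h := hΓ.image (hf i) hc
    rwa [(hz i).1, (hz i).2] at h
  simpa [mul_assoc] using IsCurveOfLengthLE.iUnion hi

end Vertices

section NormedSpace

variable {E : Type*} [NormedAddCommGroup E] [NormedSpace ℝ E] {f : Fin (m + 1) → E → E}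
  {z : Fin (m + 2) → E} {c s : ℝ} {S : Set E}

theorem one_le_mul (hz : IsZipper f z) (hf : ∀ i, IsSimilarity c (f i))
    (hab : z 0 ≠ z (Fin.last _)) : 1 ≤ (m + 1) * c := by
  have hd : 0 < dist (z 0) (z (Fin.last _)) := dist_pos.2 hab
  have hi (i : Fin (m + 1)) :
      dist (z i.castSucc) (z i.succ) = c * dist (z 0) (z (Fin.last _)) := by
    rw [← hf i, (hz i).1, (hz i).2]
  have hle : dist (z 0) (z (Fin.last _)) ≤ ∑ i : Fin (m + 1), dist (z i.castSucc) (z i.succ) :=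
    (IsCurveOfLengthLE.iUnion fun i => .segment (z i.castSucc) (z i.succ)).dist_le
  rw [Fintype.sum_congr _ _ hi] at hle
  refine le_of_mul_le_mul_right ?_ hd
  simpa [mul_assoc] using hle

theorem one_le_of_mul_rpow_eq_one (hz : IsZipper f z) (hf : ∀ i, IsSimilarity c (f i))
    (hab : z 0 ≠ z (Fin.last _)) (hc₀ : 0 < c) (hc₁ : c < 1) (hs : (m + 1) * c ^ s = 1) :
    1 ≤ s := by
  have hle : c ^ s ≤ c ^ (1 : ℝ) := by
    refine le_of_mul_le_mul_left ?_ (Nat.cast_add_one_pos (α := ℝ) m)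
    rw [hs, Real.rpow_one]
    exact hz.one_le_mul hf hab
  exact (Real.rpow_le_rpow_left_iff_of_base_lt_one hc₀ hc₁).1 hle

variable [StrictConvexSpace ℝ E] [FiniteDimensional ℝ E]

theorem exists_isCurveOfLengthLE (hz : IsZipper f z) (hf : ∀ i, IsSimilarity c (f i))
    (hc : 0 < c) (hS : IsCompact S) (hfS : S = ⋃ i, f i '' S) :
    ∃ L, ∀ n : ℕ, ∃ Γ, IsCurveOfLengthLE (((m + 1) * c) ^ n * L) (z 0) (z (Fin.last _)) Γ ∧
      Metric.cthickening (c ^ n) S ⊆ Metric.cthickening (c ^ (n + 1)) Γ := by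
  obtain ⟨L, Γ₀, hΓ₀, hcover₀⟩ :=
    IsCurveOfLengthLE.exists_cthickening_subset hS 1 hc (z 0) (z (Fin.last _))
  refine ⟨L, fun n => ?_⟩
  induction n with
  | zero => exact ⟨Γ₀, by simpa using hΓ₀, by simpa using hcover₀⟩
  | succ n ih =>
    obtain ⟨Γ, hΓ, hcover⟩ := ih
    refine ⟨⋃ i, f i '' Γ, ?_, ?_⟩
    · rw [pow_succ', mul_assoc]
      exact hz.isCurveOfLengthLE_iUnion_image hf hc hΓ
    · have hsurj (i : Fin (m + 1)) : Function.Surjective (f i) := (hf i).surjective hc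
      conv_lhs => rw [hfS]
      rw [pow_succ', pow_succ' c (n + 1), cthickening_iUnion_image hf hsurj hc hS (by positivity),
        cthickening_iUnion_image hf hsurj hc hΓ.isRectifiableCurve.isCompact (by positivity)]
      exact iUnion_mono fun i => image_mono hcover

end NormedSpace

end IsZipper

/-! ### The maximum distance problem for attractors of zippers -/

theorem mul_pow_eq_rpow_one_sub {N c s : ℝ} (hc : 0 < c) (hs : N * c ^ s = 1) (n : ℕ) :
    (N * c) ^ n = (c ^ n) ^ (1 - s) := by
  have hN : N = c ^ (-s) := by
    rw [Real.rpow_neg hc.le]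
    exact eq_inv_of_mul_eq_one_left hs
  rw [← Real.rpow_pow_comm hc.le, hN, ← Real.rpow_add_one hc.ne', neg_add_eq_sub]

theorem div_mul_rpow_one_sub_le_pow_mul {N c s ε r : ℝ} {n : ℕ} (hc : 0 < c) (hN : 0 < N)
    (hs₁ : 1 ≤ s) (hs : N * c ^ s = 1) (hε : 0 < ε) (hr : c ^ (n + 1) < r / ε) :
    ε / N * (r / ε) ^ (1 - s) ≤ N ^ n * r := by
  calc ε / N * (r / ε) ^ (1 - s)
      ≤ ε / N * (c ^ (n + 1)) ^ (1 - s) := by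
        gcongr ε / N * ?_
        exact Real.rpow_le_rpow_of_nonpos (by positivity) hr.le (sub_nonpos.2 hs₁)
    _ = N ^ n * (c ^ (n + 1) * ε) := by
      rw [← mul_pow_eq_rpow_one_sub hc hs]
      field_simp
      ring
    _ ≤ N ^ n * r := by
      gcongr
      exact ((lt_div_iff₀ hε).1 hr).le

theorem ofReal_div_mul_rpow_le_maxDistValue {d : ℕ} {S : Set (EuclideanSpace ℝ (Fin d))}
    {a b : EuclideanSpace ℝ (Fin d)} {ι : Type*} [Fintype ι] [Nonempty ι] {c s ε r : ℝ}
    (ha : a ∈ S) (hb : b ∈ S) (hε : 0 < ε) (hab : 2 * ε ≤ dist a b) (hc₀ : 0 < c) (hc₁ : c < 1)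
    (hs₁ : 1 ≤ s) (hs : Fintype.card ι * c ^ s = 1)
    (hsep : ∀ n : ℕ, ∃ x : List.Vector ι n → EuclideanSpace ℝ (Fin d),
      (∀ w, x w ∈ S) ∧ Pairwise fun w w' => c ^ n * (4 * ε) ≤ dist (x w) (x w')) (hr : 0 < r) :
    ENNReal.ofReal (ε / Fintype.card ι * (r / ε) ^ (1 - s)) ≤
      maxDistValue (Metric.cthickening r S) r := by
  have hcard : (1 : ℝ) ≤ Fintype.card ι := Nat.one_le_cast.2 Fintype.card_pos
  rcases le_or_gt r ε with hrε | hεr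
  · obtain ⟨n, hnr, hrn⟩ :=
      exists_nat_pow_near_of_lt_one (div_pos hr hε) ((div_le_one hε).2 hrε) hc₀ hc₁
    obtain ⟨x, hxS, hx⟩ := hsep n
    rw [div_le_iff₀ hε] at hrn
    calc ENNReal.ofReal (ε / Fintype.card ι * (r / ε) ^ (1 - s))
        ≤ ENNReal.ofReal (Fintype.card ι ^ n * r) := ENNReal.ofReal_le_ofReal <|
          div_mul_rpow_one_sub_le_pow_mul hc₀ (by positivity) hs₁ hs hε hnr
      _ = Fintype.card (List.Vector ι n) * ENNReal.ofReal r := by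
        rw [ENNReal.ofReal_mul (by positivity), card_vector, ← Nat.cast_pow, ENNReal.ofReal_natCast]
      _ ≤ maxDistValue (Metric.cthickening r S) r :=
        card_mul_le_maxDistValue hr.le ha hb (by linarith) hxS fun w w' hne => by
          linarith [hx hne]
  · have hpow : (r / ε) ^ (1 - s) ≤ 1 :=
      Real.rpow_le_one_of_one_le_of_nonpos ((one_le_div hε).2 hεr.le) (sub_nonpos.2 hs₁)
    calc ENNReal.ofReal (ε / Fintype.card ι * (r / ε) ^ (1 - s))
        ≤ ENNReal.ofReal (dist a b) := ENNReal.ofReal_le_ofReal <| by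
          linarith [mul_le_mul (div_le_self hε.le hcard) hpow (by positivity) hε.le]
      _ ≤ maxDistValue (Metric.cthickening r S) r := ofReal_dist_le_maxDistValue hr.le ha hb

section Attractor

variable {d m : ℕ} {f : Fin (m + 1) → EuclideanSpace ℝ (Fin d) → EuclideanSpace ℝ (Fin d)}
  {z : Fin (m + 2) → EuclideanSpace ℝ (Fin d)} {c s : ℝ} {S : Set (EuclideanSpace ℝ (Fin d))}

theorem IsZipper.exists_maxDistValue_le (hz : IsZipper f z) (hf : ∀ i, IsSimilarity c (f i))
    (hab : z 0 ≠ z (Fin.last _)) (hc₀ : 0 < c) (hc₁ : c < 1) (hs : (m + 1) * c ^ s = 1)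
    (hS : IsCompact S) (hfS : S = ⋃ i, f i '' S) :
    ∃ L, ∀ r, 0 < r → r ≤ 1 →
      maxDistValue (Metric.cthickening r S) r ≤ ENNReal.ofReal (L * r ^ (1 - s)) := by
  obtain ⟨L, hL⟩ := hz.exists_isCurveOfLengthLE hf hc₀ hS hfS
  have hL₀ : 0 ≤ L := by
    obtain ⟨Γ, hΓ, -⟩ := hL 0
    simpa using hΓ.1
  refine ⟨L, fun r hr₀ hr₁ => ?_⟩
  obtain ⟨n, hnr, hrn⟩ := exists_nat_pow_near_of_lt_one hr₀ hr₁ hc₀ hc₁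
  obtain ⟨Γ, hΓ, hcover⟩ := hL n
  calc maxDistValue (Metric.cthickening r S) r
      ≤ ENNReal.ofReal (((m + 1) * c) ^ n * L) := hΓ.maxDistValue_le <|
        (Metric.cthickening_mono hrn S).trans (hcover.trans (Metric.cthickening_mono hnr.le Γ))
    _ ≤ ENNReal.ofReal (L * r ^ (1 - s)) := by
      rw [mul_pow_eq_rpow_one_sub hc₀ hs, mul_comm]
      gcongr ENNReal.ofReal (L * ?_)
      exact Real.rpow_le_rpow_of_nonpos hr₀ hrn
        (sub_nonpos.2 (hz.one_le_of_mul_rpow_eq_one hf hab hc₀ hc₁ hs))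

theorem IsZipper.exists_le_maxDistValue (hz : IsZipper f z) (hf : ∀ i, IsSimilarity c (f i))
    (hab : z 0 ≠ z (Fin.last _)) (hc₀ : 0 < c) (hc₁ : c < 1) (hs : (m + 1) * c ^ s = 1)
    (hS : IsClosed S) (hfS : S = ⋃ i, f i '' S) {O : Set (EuclideanSpace ℝ (Fin d))}
    (hO : IsFeasibleOpenSet f O) (hOS : (O ∩ S).Nonempty) :
    ∃ k > 0, ∀ r > 0,
      ENNReal.ofReal (k * r ^ (1 - s)) ≤ maxDistValue (Metric.cthickening r S) r := by
  obtain ⟨δ, hδ, hsep⟩ :=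
    hO.exists_separated hf (fun i => (hf i).surjective hc₀) hc₀ hOS hfS
  obtain ⟨ha, hb⟩ := hz.vertices_mem hf hc₁ hS hOS.right hfS
  have hs₁ : 1 ≤ s := hz.one_le_of_mul_rpow_eq_one hf hab hc₀ hc₁ hs
  obtain ⟨ε, hε, hεle⟩ := exists_between (lt_min (div_pos hδ four_pos) (half_pos (dist_pos.2 hab)))
  obtain ⟨hεδ, hεd⟩ := lt_min_iff.1 hεle
  have hsep' (n : ℕ) : ∃ x : List.Vector (Fin (m + 1)) n → EuclideanSpace ℝ (Fin d),
      (∀ w, x w ∈ S) ∧ Pairwise fun w w' => c ^ n * (4 * ε) ≤ dist (x w) (x w') := by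
    obtain ⟨x, hxS, hx⟩ := hsep n
    exact ⟨x, hxS, fun w w' hne => le_trans (by gcongr; linarith) (hx hne)⟩
  refine ⟨ε / (m + 1) / ε ^ (1 - s), by positivity, fun r hr => ?_⟩
  rw [div_mul_eq_mul_div, mul_div_assoc, ← Real.div_rpow hr.le hε.le]
  simpa using ofReal_div_mul_rpow_le_maxDistValue ha hb hε (by linarith) hc₀ hc₁ hs₁
    (by simpa using hs) hsep' hr

end Attractor

theorem mainTheorem3_general {d m : ℕ}
    {f : Fin (m + 1) → EuclideanSpace ℝ (Fin d) → EuclideanSpace ℝ (Fin d)}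
    {z : Fin (m + 2) → EuclideanSpace ℝ (Fin d)} {c s : ℝ} {S O : Set (EuclideanSpace ℝ (Fin d))}
    (hc₀ : 0 < c) (hc₁ : c < 1) (hf : ∀ i, IsSimilarity c (f i)) (hz : IsZipper f z)
    (hab : z 0 ≠ z (Fin.last _)) (hs : (m + 1) * c ^ s = 1) (hS : IsCompact S)
    (hfS : S = ⋃ i, f i '' S) (hO : IsFeasibleOpenSet f O) (hOS : (O ∩ S).Nonempty) :
    ∃ C : ℝ, 1 < C ∧ ∀ r : ℝ, 0 < r → r < 1 →
      ENNReal.ofReal (C⁻¹ * r ^ (1 - s)) ≤ maxDistValue (Metric.cthickening r S) r ∧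
        maxDistValue (Metric.cthickening r S) r ≤ ENNReal.ofReal (C * r ^ (1 - s)) := by
  obtain ⟨L, hL⟩ := hz.exists_maxDistValue_le hf hab hc₀ hc₁ hs hS hfS
  obtain ⟨k, hk, hle⟩ := hz.exists_le_maxDistValue hf hab hc₀ hc₁ hs hS.isClosed hfS hO hOS
  obtain ⟨C, hC⟩ := exists_gt (max 1 (max L k⁻¹))
  obtain ⟨hC₁, hCL, hCk⟩ : 1 < C ∧ L < C ∧ k⁻¹ < C := by simpa only [max_lt_iff] using hC
  refine ⟨C, hC₁, fun r hr₀ hr₁ => ⟨le_trans ?_ (hle r hr₀), (hL r hr₀ hr₁.le).trans ?_⟩⟩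
  · gcongr
    exact inv_le_of_inv_le₀ hk hCk.le
  · gcongr

/-! ### The von Koch curve -/

/-- The vertices of the polygonal line that generates the von Koch curve. -/
noncomputable def kochVertex : Fin 5 → EuclideanSpace ℝ (Fin 2) :=
  ![!₂[0, 0], !₂[1 / 3, 0], !₂[1 / 2, √3 / 6], !₂[2 / 3, 0], !₂[1, 0]]

theorem isSimilarity_kochMap (i : Fin 4) : IsSimilarity (1 / 3) (kochMap i) := fun p q => by
  rw [dist_kochMap, one_div_mul_eq_div]

theorem isZipper_kochMap : IsZipper kochMap kochVertex := by
  intro i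
  constructor <;> ext j <;> fin_cases i <;> fin_cases j <;> simp [kochMap, kochVertex] <;> ring

/-- The open triangle under the tent with vertices `(0, 0)`, `(1/2, √3/6)`, `(1, 0)`, which
witnesses the open set condition for the Koch maps. -/
def kochTriangle : Set (EuclideanSpace ℝ (Fin 2)) :=
  {p | 0 < p 1 ∧ √3 * p 1 < p 0 ∧ √3 * p 1 < 1 - p 0}

theorem isOpen_kochTriangle : IsOpen kochTriangle := by
  refine IsOpen.and ?_ (IsOpen.and ?_ ?_) <;> exact isOpen_lt (by fun_prop) (by fun_prop)

theorem mapsTo_kochMap_kochTriangle (i : Fin 4) :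
    MapsTo (kochMap i) kochTriangle kochTriangle := by
  rintro p ⟨h₀, h₁, h₂⟩
  have h3 : √3 * √3 = (3 : ℝ) := Real.mul_self_sqrt (by norm_num)
  have hpos : 0 < √(3 : ℝ) := by positivity
  fin_cases i <;> refine ⟨?_, ?_, ?_⟩ <;>
    simp only [kochMap, Matrix.cons_val_zero, Matrix.cons_val_one, Matrix.cons_val_fin_one] <;>
    nlinarith

theorem kochMap_zero_mem_Ioo (i : Fin 4) {p : EuclideanSpace ℝ (Fin 2)} (hp : p ∈ kochTriangle) :
    kochMap i p 0 ∈ Ioo (kochVertex i.castSucc 0) (kochVertex i.succ 0) := by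
  obtain ⟨h₀, h₁, h₂⟩ := hp
  have hpos : 0 < √(3 : ℝ) * p 1 := by positivity
  fin_cases i <;> constructor <;>
    simp only [kochMap, kochVertex, Fin.isValue, Fin.zero_eta, Fin.mk_one, Fin.reduceFinMk,
      Fin.reduceSucc, Fin.reduceCastSucc, Matrix.cons_val] <;>
    linarith

theorem monotone_kochVertex_zero : Monotone fun i => kochVertex i 0 :=
  Fin.monotone_iff_le_succ.2 fun i => by
    fin_cases i <;>
      simp only [kochVertex, Fin.isValue, Fin.zero_eta, Fin.mk_one, Fin.reduceFinMk,
        Fin.reduceSucc, Fin.reduceCastSucc, Matrix.cons_val] <;>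
      norm_num

theorem isFeasibleOpenSet_kochTriangle : IsFeasibleOpenSet kochMap kochTriangle where
  isOpen := isOpen_kochTriangle
  mapsTo := mapsTo_kochMap_kochTriangle
  pairwise_disjoint_image i j hij := by
    wlog hlt : i < j generalizing i j
    · exact (this j i hij.symm (hij.lt_or_gt.resolve_left hlt)).symm
    rw [disjoint_left]
    rintro _ ⟨p, hp, rfl⟩ ⟨q, hq, hqp⟩
    have hpi := (kochMap_zero_mem_Ioo i hp).2
    have hqj := (kochMap_zero_mem_Ioo j hq).1
    rw [hqp] at hqj
    exact (hpi.trans_le (monotone_kochVertex_zero (Fin.succ_le_castSucc_iff.2 hlt))).not_gt hqj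

theorem kochTriangle_inter_vonKochSnowflake_nonempty :
    (kochTriangle ∩ vonKochSnowflake).Nonempty := by
  obtain ⟨hcomp, hne, hS⟩ := isKochInvariant_vonKochSnowflake
  have h₀ : kochVertex 0 ∈ vonKochSnowflake :=
    (isZipper_kochMap.vertices_mem isSimilarity_kochMap (by norm_num) hcomp.isClosed hne hS).1
  have hmaps := mapsTo_of_eq_iUnion_image hS
  have hpt : kochMap 1 (kochMap 1 (kochVertex 0)) = !₂[7 / 18, √3 / 18] := by
    ext j
    fin_cases j <;> simp [kochMap, kochVertex] <;> ring
  have h3 : √3 * √3 = (3 : ℝ) := Real.mul_self_sqrt (by norm_num)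
  refine ⟨_, ?_, hmaps 1 (hmaps 1 h₀)⟩
  rw [hpt]
  refine ⟨?_, ?_, ?_⟩ <;> simp only [Matrix.cons_val_zero, Matrix.cons_val_one,
    Matrix.cons_val_fin_one]
  · positivity
  · linarith
  · linarith

theorem logb_sub_one_div_logb {a b : ℝ} (h : Real.logb a b ≠ 0) :
    (Real.logb a b - 1) / Real.logb a b = 1 - Real.logb b a := by
  rw [sub_div, div_self h, one_div, Real.inv_logb]

theorem mul_one_div_rpow_logb {b x : ℝ} (hb : 1 < b) (hx : 0 < x) :
    x * (1 / b) ^ Real.logb b x = 1 := by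
  have hb₀ : 0 < b := zero_lt_one.trans hb
  rw [one_div, Real.inv_rpow hb₀.le, Real.rpow_logb hb₀ hb.ne' hx, mul_inv_cancel₀ hx.ne']

theorem mainTheorem3 :
    ∃ C : ℝ, 1 < C ∧ ∀ r : ℝ, 0 < r → r < 1 →
      ENNReal.ofReal (C⁻¹ * r ^ ((Real.logb 4 3 - 1) / Real.logb 4 3)) ≤
          maxDistValue (Metric.cthickening r vonKochSnowflake) r ∧
        maxDistValue (Metric.cthickening r vonKochSnowflake) r ≤
          ENNReal.ofReal (C * r ^ ((Real.logb 4 3 - 1) / Real.logb 4 3)) := by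
  have hs : ((3 : ℕ) + 1) * (1 / 3 : ℝ) ^ Real.logb 3 4 = 1 := by
    convert mul_one_div_rpow_logb (b := 3) (x := 4) (by norm_num) (by norm_num) using 2
    norm_num
  rw [logb_sub_one_div_logb (Real.logb_pos (by norm_num) (by norm_num)).ne']
  exact mainTheorem3_general (by norm_num) (by norm_num) isSimilarity_kochMap isZipper_kochMap
    (by simp [kochVertex]) hs isKochInvariant_vonKochSnowflake.1
    isKochInvariant_vonKochSnowflake.2.2 isFeasibleOpenSet_kochTriangle
    kochTriangle_inter_vonKochSnowflake_nonempty
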